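/- **Setting.** Fix an integer $L\ge 2$ and reals $0<\lambda<1$, $\sigma^2>0$, $P_{\mathsf p}>0$, $P_{\max}>0$, $\theta_{\mathsf p}>0$, $\theta_{\mathsf s}>0$; put $\gamma_{\mathsf p}=P_{\mathsf p}/\sigma^2$ and $\gamma_{\max}=P_{\max}/\sigma^2$. A primary link with a single-antenna transmitter and receiver has the random channel $h_{\mathsf p}\sim\mathcal{CN}(0,1)$ and channel power $g_{\mathsf p}=|h_{\mathsf p}|^2$. A secondary transmitter (SU) with $L$ antennas has the channel $\mathbf h_{\mathsf s}\in\mathbb C^L$ to its own receiver, with i.i.d. $\mathcal{CN}(0,1)$ entries, and the channel $\mathbf h_{\mathsf x}\in\mathbb C^L$ to the primary receiver, with i.i.d. $\mathcal{CN}(0,\lambda)$ entries. The three channels are independent. Write $g_{\mathsf s}=\|\mathbf h_{\mathsf s}\|^2$, $\mathbf s_{\mathsf s}=\mathbf h_{\mathsf s}/\|\mathbf h_{\mathsf s}\|$, $g_{\mathsf x}=\|\mathbf h_{\mathsf x}\|^2/\lambda$, $\mathbf s_{\mathsf x}=\mathbf h_{\mathsf x}/\|\mathbf h_{\mathsf x}\|$.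 *Quantized CDI ($B$ bits).* The direction $\mathbf s_{\mathsf x}$ is quantized to a random unit vector $\hat{\mathbf s}_{\mathsf x}$. The quantizer acts on $\mathbf s_{\mathsf x}$ only: $(\mathbf s_{\mathsf x},\hat{\mathbf s}_{\mathsf x})$ is independent of $g_{\mathsf x}$, and $(\mathbf h_{\mathsf x},\hat{\mathbf s}_{\mathsf x})$, $h_{\mathsf p}$, $\mathbf h_{\mathsf s}$ are mutually independent. Its error $\epsilon=1-|\hat{\mathbf s}_{\mathsf x}^\dagger\mathbf s_{\mathsf x}|^2$ satisfies $\Pr(\epsilon\le\tau)=2^B\tau^{L-1}$ for $0\le\tau\le 2^{-B/(L-1)}$ and $\Pr(\epsilon\le\tau)=1$ for $\tau>2^{-B/(L-1)}$. *Quantized interference-power control (IPC, $A$ bits), without feedforward.* Let $\omega=\sigma^2(\gamma_{\mathsf p}g_{\mathsf p}/\theta_{\mathsf p}-1)$, and let $\eta=\omega/(\lambda g_{\mathsf x}\epsilon)$ if $\omega\ge 0$, $\eta=P_{\max}$ otherwise. With $N=2^A$, the codebook $\mathcal P=\{p_0<p_1<\dots<p_{N-1}\}$ is the equal-probability one: $p_0=0$,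 $\Pr(p_n<\eta\le p_{n+1}\mid\gamma_{\mathsf p}g_{\mathsf p}\ge\theta_{\mathsf p})=1/N$ for $0\le n\le N-2$, and $\Pr(\eta>p_{N-1}\mid\gamma_{\mathsf p}g_{\mathsf p}\ge\theta_{\mathsf p})=1/N$. The quantized IPC signal is $\hat\eta=\max\{p\in\mathcal P:p\le\eta\}$ if $\omega\ge 0$ and $\eta<P_{\max}$, and $\hat\eta=P_{\max}$ otherwise. *Orthogonal cognitive beamforming (OCB).* The beamformer $\mathbf f_{\mathsf o}\in\mathbb C^L$ maximizes $|\mathbf f^\dagger\mathbf s_{\mathsf s}|^2$ subject to $\mathbf f^\dagger\hat{\mathbf s}_{\mathsf x}=0$ and $\|\mathbf f\|^2\le\hat\eta$. The SU receive SNR is $\mathsf{SNR}_{\mathsf s}=\frac{g_{\mathsf s}}{\sigma^2}|\mathbf f_{\mathsf o}^\dagger\mathbf s_{\mathsf s}|^2$, and the SU outage probability is $\hat P_{\mathsf{out}}=\Pr(\mathsf{SNR}_{\mathsf s}\le\theta_{\mathsf s})$. **Proposition.** Let $\Gamma(s,x)=\int_x^\infty t^{s-1}e^{-t}\,dt$,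 $$\varphi=e^{-\theta_{\mathsf p}/\gamma_{\mathsf p}}\,\frac{(L-1)\lambda\theta_{\mathsf p}\theta_{\mathsf s}\,\Gamma(L-2,\theta_{\mathsf s}/\gamma_{\max})}{\gamma_{\mathsf p}\,\Gamma(L-1)},\qquad \alpha=e^{-\theta_{\mathsf p}/\gamma_{\mathsf p}}\,\frac{\Gamma(L-1,\theta_{\mathsf s}/\gamma_{\max})}{\Gamma(L-1)}.$$ There is a constant $C$ depending only on $L,\lambda,\sigma^2,P_{\mathsf p},P_{\max},\theta_{\mathsf p},\theta_{\mathsf s}$ (not on $A$ and $B$) such that for all integers $A,B\ge 0$ $$\hat P_{\mathsf{out}}\le 1-\frac{\Gamma(L-1,\theta_{\mathsf s}/\gamma_{\max})}{\Gamma(L-1)}+\varphi\,2^{-B/(L-1)}+\alpha\,2^{-A}+C\,2^{-2B/(L-1)}.$$ -/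

import Mathlib

open MeasureTheory ProbabilityTheory

universe u

noncomputable section

/-- The upper incomplete gamma function `Γ(s, x) = ∫_x^∞ t^(s-1) e^(-t) dt` (used for `x > 0`). -/
def upperGamma (s x : ℝ) : ℝ := ∫ t in Set.Ioi x, t ^ (s - 1) * Real.exp (-t)

/-- The circularly symmetric complex Gaussian law `CN(0, v)`: the real and imaginary parts are
independent centred real Gaussians of variance `v / 2`. -/
def complexNormal (v : NNReal) : Measure ℂ :=
  ((gaussianReal 0 (v / 2)).prod (gaussianReal 0 (v / 2))).map Complex.measurableEquivRealProd.symm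

/-- The shape `h / ‖h‖` of a channel vector. -/
def channelShape {L : ℕ} (h : EuclideanSpace ℂ (Fin L)) : EuclideanSpace ℂ (Fin L) :=
  ((‖h‖⁻¹ : ℝ) : ℂ) • h

/-- Deterministic parameters of the network. -/
structure SystemParams where
  /-- number of antennas of the secondary transmitter -/
  L : ℕ
  /-- relative path loss of the cross link -/
  lam : ℝ
  /-- noise variance `σ²` -/
  noise : ℝ
  /-- primary transmission power -/
  Pp : ℝ
  /-- maximum secondary transmission power -/
  Pmax : ℝ
  /-- primary SINR threshold -/
  thetaP : ℝ
  /-- secondary SNR threshold -/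
  thetaS : ℝ
  two_le_L : 2 ≤ L
  lam_pos : 0 < lam
  lam_lt_one : lam < 1
  noise_pos : 0 < noise
  Pp_pos : 0 < Pp
  Pmax_pos : 0 < Pmax
  thetaP_pos : 0 < thetaP
  thetaS_pos : 0 < thetaS

namespace SystemParams

variable (S : SystemParams)

/-- Primary transmit SNR `γ_p = P_p / σ²`. -/
def gammaP : ℝ := S.Pp / S.noise

/-- Maximum secondary transmit SNR `γ_max = P_max / σ²`. -/
def gammaMax : ℝ := S.Pmax / S.noise

/-- The coefficient `φ` of the CDI quantization term. -/
def phi : ℝ :=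
  Real.exp (-(S.thetaP / S.gammaP)) *
    ((((S.L : ℝ) - 1) * S.lam * S.thetaP * S.thetaS *
        upperGamma ((S.L : ℝ) - 2) (S.thetaS / S.gammaMax)) /
      (S.gammaP * Real.Gamma ((S.L : ℝ) - 1)))

/-- The coefficient `α` of the IPC quantization term. -/
def alpha : ℝ :=
  Real.exp (-(S.thetaP / S.gammaP)) *
    (upperGamma ((S.L : ℝ) - 1) (S.thetaS / S.gammaMax) / Real.Gamma ((S.L : ℝ) - 1))

end SystemParams

/-- The random channels, together with the CDI quantized to `B` bits.
The fields `indep_*` say that the three channels are independent, that the CDI quantizer acts on the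
shape of the cross channel only (so it sees neither the other channels nor the gain of the cross
channel). The fields `cdf_*` are the sphere-cap model of a `B`-bit quantizer. -/
structure ChannelModel (S : SystemParams) (B : ℕ) {Ω : Type*} [MeasurableSpace Ω]
    (μ : Measure Ω) where
  /-- primary link -/
  hp : Ω → ℂ
  /-- cross link, from the secondary transmitter to the primary receiver -/
  hx : Ω → EuclideanSpace ℂ (Fin S.L)
  /-- secondary link -/
  hs : Ω → EuclideanSpace ℂ (Fin S.L)
  /-- quantized shape of the cross link -/
  sHat : Ω → EuclideanSpace ℂ (Fin S.L)
  measurable_hp : Measurable hp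
  measurable_hx : Measurable hx
  measurable_hs : Measurable hs
  measurable_sHat : Measurable sHat
  law_hp : μ.map hp = complexNormal 1
  /-- the entries of `hx` are i.i.d. `CN(0, λ)` -/
  law_hx : μ.map (fun w i => hx w i) = Measure.pi fun _ => complexNormal S.lam.toNNReal
  /-- the entries of `hs` are i.i.d. `CN(0, 1)` -/
  law_hs : μ.map (fun w i => hs w i) = Measure.pi fun _ => complexNormal 1
  norm_sHat : ∀ w, ‖sHat w‖ = 1
  indep_primary : IndepFun hp (fun w => (hx w, sHat w)) μ
  indep_secondary : IndepFun (fun w => (hp w, hx w, sHat w)) hs μ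
  indep_gain : IndepFun (fun w => ‖hx w‖) (fun w => (channelShape (hx w), sHat w)) μ
  cdf_le : ∀ τ : ℝ, 0 ≤ τ → τ ≤ (2 : ℝ) ^ (-(B : ℝ) / ((S.L : ℝ) - 1)) →
    μ.real {w | 1 - ‖inner ℂ (sHat w) (channelShape (hx w))‖ ^ 2 ≤ τ} = 2 ^ B * τ ^ (S.L - 1)
  cdf_gt : ∀ τ : ℝ, (2 : ℝ) ^ (-(B : ℝ) / ((S.L : ℝ) - 1)) < τ →
    μ.real {w | 1 - ‖inner ℂ (sHat w) (channelShape (hx w))‖ ^ 2 ≤ τ} = 1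

/-- `⌊x⌋_P`, the largest element `≤ x` of the codebook `P = {p 0, p 1, …}`, for `x ≥ 0 = p 0`. -/
def codebookFloor {N : ℕ} (p : Fin N → ℝ) (x : ℝ) : ℝ := sSup {q | q ∈ Set.range p ∧ q ≤ x}

/-- `f` solves the orthogonal cognitive beamforming problem: maximize `|f† s|²` subject to
`f† ŝ = 0` and `‖f‖² ≤ P`. -/
def IsOCBBeamformer {L : ℕ} (sHat s : EuclideanSpace ℂ (Fin L)) (P : ℝ)
    (f : EuclideanSpace ℂ (Fin L)) : Prop :=
  (inner ℂ f sHat = 0 ∧ ‖f‖ ^ 2 ≤ P) ∧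
    ∀ g : EuclideanSpace ℂ (Fin L), inner ℂ g sHat = 0 → ‖g‖ ^ 2 ≤ P →
      ‖inner ℂ g s‖ ^ 2 ≤ ‖inner ℂ f s‖ ^ 2

namespace ChannelModel

variable {S : SystemParams} {B : ℕ} {Ω : Type*} [MeasurableSpace Ω] {μ : Measure Ω}
  (X : ChannelModel S B μ)

/-- Primary channel power. -/
def gp (w : Ω) : ℝ := ‖X.hp w‖ ^ 2

/-- Cross channel gain, normalized by the path loss. -/
def gx (w : Ω) : ℝ := ‖X.hx w‖ ^ 2 / S.lam

/-- Secondary channel gain. -/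
def gs (w : Ω) : ℝ := ‖X.hs w‖ ^ 2

/-- CDI quantization error `ε = 1 - |ŝ† s|²`. -/
def eps (w : Ω) : ℝ := 1 - ‖inner ℂ (X.sHat w) (channelShape (X.hx w))‖ ^ 2

/-- Interference margin `ω` of the primary receiver. -/
def margin (w : Ω) : ℝ := S.noise * (S.gammaP * X.gp w / S.thetaP - 1)

open Classical in
/-- Unquantized IPC signal `η` (without feedforward). -/
def eta (w : Ω) : ℝ :=
  if 0 ≤ X.margin w then X.margin w / (S.lam * X.gx w * X.eps w) else S.Pmax

/-- `p` lists, in increasing order, the equal-probability IPC codebook with `2 ^ A` elements. -/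
structure IsIPCCodebook {A : ℕ} (p : Fin (2 ^ A) → ℝ) : Prop where
  strictMono : StrictMono p
  zero : p ⟨0, Nat.two_pow_pos A⟩ = 0
  step : ∀ (n : ℕ) (h : n + 1 < 2 ^ A),
    (μ[|{w | S.thetaP ≤ S.gammaP * X.gp w}]).real
      {w | p ⟨n, Nat.lt_of_succ_lt h⟩ < X.eta w ∧ X.eta w ≤ p ⟨n + 1, h⟩} = 1 / 2 ^ A
  last : (μ[|{w | S.thetaP ≤ S.gammaP * X.gp w}]).real
      {w | p ⟨2 ^ A - 1, Nat.sub_one_lt_of_lt (Nat.two_pow_pos A)⟩ < X.eta w} = 1 / 2 ^ A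

open Classical in
/-- Quantized IPC signal `η̂`. -/
def etaHat {N : ℕ} (p : Fin N → ℝ) (w : Ω) : ℝ :=
  if 0 ≤ X.margin w ∧ X.eta w < S.Pmax then codebookFloor p (X.eta w) else S.Pmax

/-- Receive SNR of the secondary link under the beamformer `f`. -/
def snrS (f : Ω → EuclideanSpace ℂ (Fin S.L)) (w : Ω) : ℝ :=
  X.gs w / S.noise * ‖inner ℂ (f w) (channelShape (X.hs w))‖ ^ 2

/-- Outage probability of the secondary link under the beamformer `f`. -/
def outage (f : Ω → EuclideanSpace ℂ (Fin S.L)) : ℝ := μ.real {w | X.snrS f w ≤ S.thetaS}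

end ChannelModel

end

/-!
Let `Y` be the gain of the secondary channel orthogonal to the quantized cross-channel shape. It is
`Gamma (L - 1, 1)` distributed and independent of everything that determines `η`, and an outage
forces `η̂ Y ≤ c := σ² θ_s`. With `a := θ_p / γ_p`, this can happen in three ways.

* Full power does not suffice: `Y ≤ θ_s / γ_max`, which has the probability of the leading term.
* It would, but `0 ≤ ω` and `η Y ≤ c`. Given `Y` and `V = g_x ε`, this confines the exponential
  variable `g_p` to an interval `[a, a + k V / Y]`, of probability at most `e^(-a) k V / Y`.
  Averaging over the independent `g_x`, `ε` and `Y` gives `φ 2^(-B/(L-1))`.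
* It would, but only the rounding of `η` down to the codebook is to blame: no codebook element lies
  in `(c / Y, η]`, so `η` lies in the codebook cell that contains or starts at `c / Y`. Given `Y`,
  this has probability at most `e^(-a) 2^(-A)`; averaging over `Y` gives `α 2^(-A)`.

The linear bound on the probability of an interval is global rather than asymptotic, so there is no
second-order term: `C = 0` works.
-/

theorem upperGamma_nonneg (s : ℝ) {x : ℝ} (hx : 0 ≤ x) : 0 ≤ upperGamma s x :=
  setIntegral_nonneg measurableSet_Ioi fun t ht => by
    have ht0 : 0 < t := hx.trans_lt ht
    positivity

section GammaLaw

variable {a r : ℝ}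

theorem measure_ext_of_mgf_id_eq {μ ν : Measure ℝ} [IsProbabilityMeasure μ] [IsFiniteMeasure ν]
    (h : mgf id μ = mgf id ν) (h0 : 0 ∈ interior (integrableExpSet id μ)) : μ = ν := by
  refine Measure.ext_of_charFun (funext fun t => ?_)
  rw [← complexMGF_id_mul_I, ← complexMGF_id_mul_I]
  exact eqOn_complexMGF_of_mgf h (by simpa using h0)

theorem exp_mul_gammaPDFReal {t : ℝ} (hr : 0 < r) (ht : t < r) (x : ℝ) :
    Real.exp (t * x) * gammaPDFReal a r x =
      (1 - t / r) ^ (-a) * gammaPDFReal a (r - t) x := by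
  have hrt : 0 < r - t := sub_pos.2 ht
  have hpow : r ^ a = (1 - t / r) ^ (-a) * (r - t) ^ a := by
    rw [one_sub_div hr.ne', Real.div_rpow hrt.le hr.le, Real.rpow_neg hrt.le,
      Real.rpow_neg hr.le]
    field_simp
  have hexp : Real.exp (-(r * x)) = Real.exp (-(t * x)) * Real.exp (-((r - t) * x)) := by
    rw [← Real.exp_add]
    ring_nf
  unfold gammaPDFReal
  split_ifs
  · rw [hpow, hexp, Real.exp_neg (t * x)]
    field_simp
  · simp

theorem mul_gammaPDFReal (ha : 0 < a) (hr : 0 < r) (x : ℝ) :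
    x * gammaPDFReal a r x = a / r * gammaPDFReal (a + 1) r x := by
  unfold gammaPDFReal
  split_ifs with hx
  · rcases hx.eq_or_lt with rfl | hx
    · simp [ha.ne']
    · rw [Real.Gamma_add_one ha.ne', Real.rpow_add_one hr.ne', add_sub_cancel_right,
        Real.rpow_sub_one hx.ne']
      field_simp
  · simp

theorem lintegral_gammaMeasure {g : ℝ → ENNReal} (hg : Measurable g) :
    ∫⁻ x, g x ∂gammaMeasure a r = ∫⁻ x, ENNReal.ofReal (gammaPDFReal a r x) * g x :=
  lintegral_withDensity_eq_lintegral_mul _ (by unfold gammaPDF; fun_prop) hg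

theorem lintegral_ofReal_exp_mul_gammaMeasure (ha : 0 < a) {t : ℝ} (hr : 0 < r) (ht : t < r) :
    ∫⁻ x, ENNReal.ofReal (Real.exp (t * x)) ∂gammaMeasure a r =
      ENNReal.ofReal ((1 - t / r) ^ (-a)) := by
  have hc : 0 ≤ (1 - t / r) ^ (-a) :=
    Real.rpow_nonneg (sub_nonneg.2 ((div_le_one hr).2 ht.le)) _
  rw [lintegral_gammaMeasure (by fun_prop)]
  simp_rw [← ENNReal.ofReal_mul (gammaPDFReal_nonneg ha hr _), mul_comm (gammaPDFReal a r _),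
    exp_mul_gammaPDFReal hr ht, ENNReal.ofReal_mul hc]
  rw [lintegral_const_mul _ (by fun_prop)]
  exact (congrArg _ (lintegral_gammaPDF_eq_one ha (sub_pos.2 ht))).trans (mul_one _)

theorem lintegral_ofReal_gammaMeasure (ha : 0 < a) (hr : 0 < r) :
    ∫⁻ x, ENNReal.ofReal x ∂gammaMeasure a r = ENNReal.ofReal (a / r) := by
  rw [lintegral_gammaMeasure (by fun_prop)]
  simp_rw [← ENNReal.ofReal_mul (gammaPDFReal_nonneg ha hr _), mul_comm (gammaPDFReal a r _),
    mul_gammaPDFReal ha hr, ENNReal.ofReal_mul (div_pos ha hr).le]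
  rw [lintegral_const_mul _ (by fun_prop)]
  exact (congrArg _ (lintegral_gammaPDF_eq_one (by positivity) hr)).trans (mul_one _)

theorem gammaMeasure_Iic_zero : gammaMeasure a r (Set.Iic 0) = 0 := by
  rw [gammaMeasure, withDensity_apply _ measurableSet_Iic,
    setLIntegral_congr Iio_ae_eq_Iic.symm, lintegral_gammaPDF_of_nonpos le_rfl]

theorem lintegral_ofReal_exp_mul_gammaMeasure_of_le (ha : 0 < a) {t : ℝ} (hr : 0 < r)
    (ht : r ≤ t) : ∫⁻ x, ENNReal.ofReal (Real.exp (t * x)) ∂gammaMeasure a r = ⊤ := by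
  have hc : 0 < r ^ a / Real.Gamma a :=
    div_pos (Real.rpow_pos_of_pos hr _) (Real.Gamma_pos_of_pos ha)
  have hpow : ∫⁻ x in Set.Ioi 0, ENNReal.ofReal (x ^ (a - 1)) = ⊤ := by
    by_contra h
    refine not_integrableOn_Ioi_rpow (a - 1) ((lintegral_ofReal_ne_top_iff_integrable
      (by fun_prop) ?_).1 h)
    exact (ae_restrict_mem measurableSet_Ioi).mono fun x hx => Real.rpow_nonneg (le_of_lt hx) _
  rw [eq_top_iff, lintegral_gammaMeasure (by fun_prop)]
  calc ⊤ = ∫⁻ x in Set.Ioi 0, ENNReal.ofReal (r ^ a / Real.Gamma a) *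
          ENNReal.ofReal (x ^ (a - 1)) := by
        rw [lintegral_const_mul _ (by fun_prop), hpow, ENNReal.mul_top (by simpa using hc)]
    _ ≤ ∫⁻ x in Set.Ioi 0, ENNReal.ofReal (gammaPDFReal a r x) *
          ENNReal.ofReal (Real.exp (t * x)) := by
        refine setLIntegral_mono' measurableSet_Ioi fun x (hx : 0 < x) => ?_
        rw [← ENNReal.ofReal_mul hc.le, ← ENNReal.ofReal_mul (gammaPDFReal_nonneg ha hr x),
          gammaPDFReal, if_pos hx.le, mul_assoc _ (Real.exp _), ← Real.exp_add]
        have hexp : 1 ≤ Real.exp (-(r * x) + t * x) := by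
          rw [← sub_eq_neg_add, ← sub_mul]
          exact Real.one_le_exp (mul_nonneg (sub_nonneg.2 ht) hx.le)
        exact ENNReal.ofReal_le_ofReal (le_mul_of_one_le_right (by positivity) hexp)
    _ ≤ _ := setLIntegral_le_lintegral _ _

theorem integrableExpSet_id_gammaMeasure (ha : 0 < a) (hr : 0 < r) :
    integrableExpSet id (gammaMeasure a r) = Set.Iio r := by
  ext t
  refine (lintegral_ofReal_ne_top_iff_integrable (by fun_prop)
    (.of_forall fun x => (Real.exp_pos _).le)).symm.trans ?_
  rcases lt_or_ge t r with ht | ht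
  · simp [lintegral_ofReal_exp_mul_gammaMeasure ha hr ht, ht]
  · simp [lintegral_ofReal_exp_mul_gammaMeasure_of_le ha hr ht, ht]

theorem mgf_id_gammaMeasure (ha : 0 < a) (hr : 0 < r) (t : ℝ) :
    mgf id (gammaMeasure a r) t = if t < r then (1 - t / r) ^ (-a) else 0 := by
  split_ifs with ht
  · have hc : 0 ≤ (1 - t / r) ^ (-a) :=
      Real.rpow_nonneg (sub_nonneg.2 ((div_le_one hr).2 ht.le)) _
    rw [mgf, integral_eq_lintegral_of_nonneg_ae (.of_forall fun x => (Real.exp_pos _).le)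
      (by fun_prop), ← ENNReal.toReal_ofReal hc, ← lintegral_ofReal_exp_mul_gammaMeasure ha hr ht]
    rfl
  · refine mgf_undef fun h => ht ?_
    rwa [← Set.mem_Iio, ← integrableExpSet_id_gammaMeasure ha hr]

theorem eq_gammaMeasure_of_mgf_id {μ : Measure ℝ} [IsFiniteMeasure μ] (ha : 0 < a) (hr : 0 < r)
    (h : ∀ t, mgf id μ t = if t < r then (1 - t / r) ^ (-a) else 0) : μ = gammaMeasure a r := by
  have := isProbabilityMeasure_gammaMeasure ha hr
  refine (measure_ext_of_mgf_id_eq (funext fun t => ?_) ?_).symm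
  · rw [h, mgf_id_gammaMeasure ha hr]
  · rwa [integrableExpSet_id_gammaMeasure ha hr, interior_Iio, Set.mem_Iio]

theorem hasLaw_sum_gammaMeasure {Ω ι : Type*} [MeasurableSpace Ω] {μ : Measure Ω} [Fintype ι]
    [Nonempty ι] {X : ι → Ω → ℝ} (hX : iIndepFun X μ) {a : ι → ℝ} (ha : ∀ i, 0 < a i) (hr : 0 < r)
    (hlaw : ∀ i, HasLaw (X i) (gammaMeasure (a i) r) μ) :
    HasLaw (∑ i, X i) (gammaMeasure (∑ i, a i) r) μ := by
  have := hX.isProbabilityMeasure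
  have hm : AEMeasurable (∑ i, X i) μ := Finset.aemeasurable_sum _ fun i _ => (hlaw i).aemeasurable
  have hmgf (i t) : mgf (X i) μ t = if t < r then (1 - t / r) ^ (-a i) else 0 := by
    rw [← mgf_id_map (hlaw i).aemeasurable, (hlaw i).map_eq, mgf_id_gammaMeasure (ha i) hr]
  refine ⟨hm, eq_gammaMeasure_of_mgf_id
    (Finset.sum_pos (fun i _ => ha i) Finset.univ_nonempty) hr fun t => ?_⟩
  rw [mgf_id_map hm, hX.mgf_sum₀ fun i => (hlaw i).aemeasurable]
  simp_rw [hmgf]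
  split_ifs with ht
  · rw [← Finset.sum_neg_distrib, Real.rpow_sum_of_pos (by rwa [sub_pos, div_lt_one hr])]
  · simp

theorem integrableOn_rpow_mul_exp_neg_Ioi (s : ℝ) {x : ℝ} (hx : 0 < x) :
    IntegrableOn (fun t => t ^ (s - 1) * Real.exp (-t)) (Set.Ioi x) := by
  refine integrable_of_isBigO_exp_neg one_half_pos (fun t ht => ?_) ?_
  · have : t ≠ 0 := (hx.trans_le ht).ne'
    fun_prop (disch := simp [this])
  · simpa only [mul_comm] using (Real.Gamma_integrand_isLittleO (s - 1)).isBigO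

theorem setLIntegral_Ioi_rpow_gammaMeasure (ha : 0 < a) (hr : 0 < r) (c : ℝ) {y : ℝ}
    (hy : 0 < y) :
    ∫⁻ t in Set.Ioi y, ENNReal.ofReal (t ^ c) ∂gammaMeasure a r =
      ENNReal.ofReal (r ^ (-c) * upperGamma (a + c) (r * y) / Real.Gamma a) := by
  have hint : IntegrableOn (fun t => (r * t) ^ (a + c - 1) * Real.exp (-(r * t))) (Set.Ioi y) :=
    (integrableOn_Ioi_comp_mul_left_iff _ _ hr).2
      (integrableOn_rpow_mul_exp_neg_Ioi (a + c) (mul_pos hr hy))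
  have hscale : r ^ (-c) * upperGamma (a + c) (r * y) / Real.Gamma a =
      ∫ t in Set.Ioi y, r ^ (1 - c) / Real.Gamma a *
        ((r * t) ^ (a + c - 1) * Real.exp (-(r * t))) := by
    rw [integral_const_mul,
      integral_comp_mul_left_Ioi (fun u => u ^ (a + c - 1) * Real.exp (-u)) _ hr,
      smul_eq_mul, ← upperGamma, sub_eq_neg_add, Real.rpow_add_one hr.ne']
    field_simp
  rw [gammaMeasure, setLIntegral_withDensity_eq_setLIntegral_mul _ (by unfold gammaPDF; fun_prop)
    (by fun_prop) measurableSet_Ioi, hscale, ofReal_integral_eq_lintegral_ofReal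
    (hint.const_mul _)]
  · refine setLIntegral_congr_fun measurableSet_Ioi fun t (ht : y < t) => ?_
    have ht0 : 0 < t := hy.trans ht
    have hrpow : r ^ a = r ^ (1 - c) * r ^ (a + c - 1) := by
      rw [← Real.rpow_add hr]
      ring_nf
    rw [Pi.mul_apply, gammaPDF_of_nonneg ht0.le, ← ENNReal.ofReal_mul (by positivity),
      Real.mul_rpow hr.le ht0.le, add_sub_right_comm, Real.rpow_add ht0,
      ← add_sub_right_comm, hrpow]
    ring_nf
  · refine (ae_restrict_mem measurableSet_Ioi).mono fun t (ht : y < t) => ?_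
    have ht0 : 0 < t := hy.trans ht
    positivity

theorem gammaMeasure_Ioi (ha : 0 < a) (hr : 0 < r) {y : ℝ} (hy : 0 < y) :
    gammaMeasure a r (Set.Ioi y) = ENNReal.ofReal (upperGamma a (r * y) / Real.Gamma a) := by
  simpa using setLIntegral_Ioi_rpow_gammaMeasure ha hr 0 hy

theorem expMeasure_Ici (hr : 0 < r) {x : ℝ} (hx : 0 ≤ x) :
    expMeasure r (Set.Ici x) = ENNReal.ofReal (Real.exp (-(r * x))) := by
  have := isProbabilityMeasure_expMeasure hr
  have hna : NullSingletonClass (expMeasure r) := by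
    unfold expMeasure gammaMeasure
    infer_instance
  have hcdf := cdf_expMeasure_eq hr x
  rw [if_pos hx, cdf_eq_real] at hcdf
  rw [← measure_congr Ioi_ae_eq_Ici, ← Set.compl_Iic, prob_compl_eq_one_sub measurableSet_Iic,
    ← ofReal_measureReal, hcdf, ← ENNReal.ofReal_one, ← ENNReal.ofReal_sub, sub_sub_cancel]
  simpa using mul_nonneg hr.le hx

theorem expMeasure_Icc_le (hr : 0 < r) (x d : ℝ) :
    expMeasure r (Set.Icc x (x + d)) ≤
      ENNReal.ofReal (r * Real.exp (-(r * x))) * ENNReal.ofReal d := by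
  have hpdf {t : ℝ} (ht : x ≤ t) : gammaPDFReal 1 r t ≤ r * Real.exp (-(r * x)) := by
    unfold gammaPDFReal
    split_ifs
    · simp only [Real.rpow_one, Real.Gamma_one, div_one, sub_self, Real.rpow_zero, mul_one]
      gcongr
    · positivity
  rw [expMeasure, gammaMeasure, withDensity_apply _ measurableSet_Icc]
  calc ∫⁻ t in Set.Icc x (x + d), gammaPDF 1 r t
      ≤ ∫⁻ _ in Set.Icc x (x + d), ENNReal.ofReal (r * Real.exp (-(r * x))) :=
        setLIntegral_mono measurable_const fun t ht => ENNReal.ofReal_le_ofReal (hpdf ht.1)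
    _ = ENNReal.ofReal (r * Real.exp (-(r * x))) * ENNReal.ofReal d := by
        rw [setLIntegral_const, Real.volume_Icc, add_sub_cancel_left]

end GammaLaw

section ComplexGaussian

variable {v : NNReal}

instance isProbabilityMeasure_complexNormal : IsProbabilityMeasure (complexNormal v) :=
  Measure.isProbabilityMeasure_map (by fun_prop)

theorem integral_complexNormal_mul {𝕜 : Type*} [RCLike 𝕜] (f g : ℝ → 𝕜) :
    ∫ z, f z.re * g z.im ∂complexNormal v =
      (∫ x, f x ∂gaussianReal 0 (v / 2)) * ∫ x, g x ∂gaussianReal 0 (v / 2) := by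
  rw [complexNormal, integral_map_equiv, ← integral_prod_mul]
  rfl

theorem mgf_sq_gaussianReal (hv : v ≠ 0) (t : ℝ) :
    mgf (fun x => x ^ 2) (gaussianReal 0 v) t = √((1 - 2 * v * t)⁻¹) := by
  have : (0 : ℝ) < v := by positivity
  have hpdf (x : ℝ) : gaussianPDFReal 0 v x • Real.exp (t * x ^ 2) =
      (√(2 * Real.pi * v))⁻¹ * Real.exp (-(1 / (2 * v) - t) * x ^ 2) := by
    rw [gaussianPDFReal, smul_eq_mul, mul_assoc, ← Real.exp_add]
    ring_nf
  rw [mgf, integral_gaussianReal_eq_integral_smul hv]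
  simp_rw [hpdf]
  rw [integral_const_mul, integral_gaussian, ← Real.sqrt_inv, ← Real.sqrt_mul (by positivity)]
  congr 1
  rw [div_sub' (by positivity), mul_comm (2 * (v : ℝ)) t]
  field_simp

theorem hasLaw_norm_sq_complexNormal (hv : v ≠ 0) :
    HasLaw (fun z => ‖z‖ ^ 2) (expMeasure (v : ℝ)⁻¹) (complexNormal v) := by
  have hv' : (0 : ℝ) < v := by positivity
  have hm : Measurable fun z : ℂ => ‖z‖ ^ 2 := by fun_prop
  have := Measure.isProbabilityMeasure_map (μ := complexNormal v) hm.aemeasurable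
  refine ⟨hm.aemeasurable,
    eq_gammaMeasure_of_mgf_id one_pos (inv_pos.2 hv') fun t => ?_⟩
  have hmgf : mgf (fun z : ℂ => ‖z‖ ^ 2) (complexNormal v) t =
      mgf (fun x => x ^ 2) (gaussianReal 0 (v / 2)) t ^ 2 := by
    rw [sq (mgf _ _ _), mgf, mgf, ← integral_complexNormal_mul]
    simp_rw [← Real.exp_add, ← mul_add, Complex.sq_norm, Complex.normSq_apply, ← sq]
  rw [mgf_id_map hm.aemeasurable, hmgf, mgf_sq_gaussianReal (by simpa), Real.rpow_neg_one,
    div_inv_eq_mul]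
  have hcoe : 2 * ((v / 2 : NNReal) : ℝ) * t = t * v := by push_cast; ring
  rw [hcoe]
  split_ifs with ht
  · have hle : t * v ≤ 1 := ((lt_inv_mul_iff₀' hv').1 (by rwa [mul_one])).le
    exact Real.sq_sqrt (inv_nonneg.2 (sub_nonneg.2 hle))
  · have hge : 1 ≤ t * v := (inv_le_iff_one_le_mul₀ hv').1 (not_lt.1 ht)
    rw [Real.sqrt_eq_zero_of_nonpos (inv_nonpos.2 (sub_nonpos.2 hge)), zero_pow two_ne_zero]

theorem charFun_complexNormal (t : ℂ) :
    charFun (complexNormal v) t = Complex.exp (-(v * ‖t‖ ^ 2 / 4 : ℝ)) := by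
  have hinner (z : ℂ) : Complex.exp (inner ℝ z t * Complex.I) =
      Complex.exp (t.re * z.re * Complex.I) * Complex.exp (t.im * z.im * Complex.I) := by
    rw [← Complex.exp_add, Complex.inner, ← add_mul]
    simp
  have hgauss (s : ℝ) : ∫ x, Complex.exp (s * x * Complex.I) ∂gaussianReal 0 (v / 2) =
      Complex.exp (-(v * s ^ 2 / 4 : ℝ)) := by
    rw [← charFun_apply_real, charFun_gaussianReal]
    congr 1
    push_cast
    ring
  simp_rw [charFun_apply, hinner]
  rw [integral_complexNormal_mul (fun x => Complex.exp (t.re * x * Complex.I))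
    fun x => Complex.exp (t.im * x * Complex.I), hgauss, hgauss, ← Complex.exp_add, Complex.sq_norm,
    Complex.normSq_apply]
  push_cast
  ring_nf

/-- The law of a vector with i.i.d. `CN(0, v)` entries, on the Euclidean space `ℂ^ι`. -/
noncomputable def complexNormalVector (v : NNReal) (ι : Type*) [Fintype ι] :
    Measure (EuclideanSpace ℂ ι) :=
  (Measure.pi fun _ => complexNormal v).map (WithLp.toLp 2)

variable {ι κ : Type*} [Fintype ι] [Fintype κ]

instance isProbabilityMeasure_complexNormalVector :
    IsProbabilityMeasure (complexNormalVector v ι) :=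
  Measure.isProbabilityMeasure_map (by fun_prop)

theorem charFun_complexNormalVector (t : EuclideanSpace ℂ ι) :
    charFun (complexNormalVector v ι) t = Complex.exp (-(v * ‖t‖ ^ 2 / 4 : ℝ)) := by
  rw [complexNormalVector, charFun_pi]
  simp_rw [charFun_complexNormal]
  rw [← Complex.exp_sum, EuclideanSpace.norm_sq_eq, Finset.mul_sum, Finset.sum_div]
  simp

theorem real_inner_eq_re_inner_complex (x y : EuclideanSpace ℂ ι) :
    inner ℝ x y = (inner ℂ x y).re := by
  simp [PiLp.inner_apply, Complex.inner]

theorem map_adjoint_complexNormalVector (U : EuclideanSpace ℂ κ →ₗᵢ[ℂ] EuclideanSpace ℂ ι) :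
    (complexNormalVector v ι).map (ContinuousLinearMap.adjoint U.toContinuousLinearMap) =
      complexNormalVector v κ := by
  have := Measure.isProbabilityMeasure_map (μ := complexNormalVector v ι)
    (ContinuousLinearMap.adjoint U.toContinuousLinearMap).continuous.measurable.aemeasurable
  refine Measure.ext_of_charFun (funext fun t => ?_)
  rw [charFun_complexNormalVector, ← U.norm_map t, ← charFun_complexNormalVector, charFun_apply,
    charFun_apply, integral_map (by fun_prop) (by fun_prop)]
  simp_rw [real_inner_eq_re_inner_complex, ContinuousLinearMap.adjoint_inner_left,
    LinearIsometry.coe_toContinuousLinearMap]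

theorem hasLaw_norm_sq_complexNormalVector [Nonempty ι] (hv : v ≠ 0) :
    HasLaw (fun h => ‖h‖ ^ 2) (gammaMeasure (Fintype.card ι) (v : ℝ)⁻¹)
      (complexNormalVector v ι) := by
  have hind : iIndepFun (fun (i : ι) (h : ι → ℂ) => ‖h i‖ ^ 2)
      (Measure.pi fun _ => complexNormal v) :=
    iIndepFun_pi (X := fun _ z => ‖z‖ ^ 2) fun _ => by fun_prop
  have hcoord (i : ι) : HasLaw (fun h : ι → ℂ => ‖h i‖ ^ 2) (gammaMeasure 1 (v : ℝ)⁻¹)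
      (Measure.pi fun _ => complexNormal v) :=
    (hasLaw_norm_sq_complexNormal hv).comp
      (measurePreserving_eval (fun _ : ι => complexNormal v) i).hasLaw
  have hsum := hasLaw_sum_gammaMeasure hind (fun _ => one_pos)
    (inv_pos.2 (by positivity : (0 : ℝ) < v)) hcoord
  refine ⟨by fun_prop, ?_⟩
  rw [complexNormalVector, Measure.map_map (by fun_prop) (by fun_prop)]
  convert hsum.map_eq using 2
  · ext h
    simp [EuclideanSpace.norm_sq_eq]
  · simp

theorem hasLaw_norm_sq_starProjection_complexNormalVector
    (K : Submodule ℂ (EuclideanSpace ℂ ι)) [Nontrivial K] (hv : v ≠ 0) :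
    HasLaw (fun h => ‖K.starProjection h‖ ^ 2) (gammaMeasure (Module.finrank ℂ K) (v : ℝ)⁻¹)
      (complexNormalVector v ι) := by
  let U := K.subtypeₗᵢ.comp (stdOrthonormalBasis ℂ K).repr.symm.toLinearIsometry
  have hU (h : EuclideanSpace ℂ ι) :
      ‖ContinuousLinearMap.adjoint U.toContinuousLinearMap h‖ = ‖K.starProjection h‖ := by
    have hadj : ContinuousLinearMap.adjoint U.toContinuousLinearMap h =
        (stdOrthonormalBasis ℂ K).repr (K.orthogonalProjectionOnto h) := by
      refine ext_inner_right ℂ fun t => ?_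
      rw [ContinuousLinearMap.adjoint_inner_left, LinearIsometryEquiv.inner_map_eq_flip]
      exact (Submodule.inner_orthogonalProjectionOnto_eq_of_mem_right _ _).symm
    rw [hadj, LinearIsometryEquiv.norm_map, Submodule.starProjection_apply, Submodule.norm_coe]
  have : Nonempty (Fin (Module.finrank ℂ K)) := Fin.pos_iff_nonempty.1 Module.finrank_pos
  have hlaw : HasLaw (ContinuousLinearMap.adjoint U.toContinuousLinearMap)
      (complexNormalVector v _) (complexNormalVector v ι) :=
    ⟨by fun_prop, map_adjoint_complexNormalVector U⟩
  simpa [Function.comp_def, hU] using (hasLaw_norm_sq_complexNormalVector hv).comp hlaw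

theorem hasLaw_norm_sq_starProjection_orthogonal_complexNormalVector
    (hv : v ≠ 0) (hι : 1 < Fintype.card ι) {e : EuclideanSpace ℂ ι} (he : e ≠ 0) :
    HasLaw (fun h => ‖(ℂ ∙ e)ᗮ.starProjection h‖ ^ 2)
      (gammaMeasure ((Fintype.card ι : ℝ) - 1) (v : ℝ)⁻¹) (complexNormalVector v ι) := by
  have : Fact (Module.finrank ℂ (EuclideanSpace ℂ ι) = Fintype.card ι - 1 + 1) :=
    ⟨by rw [finrank_euclideanSpace, Nat.sub_add_cancel hι.le]⟩
  have hrank : Module.finrank ℂ (ℂ ∙ e)ᗮ = Fintype.card ι - 1 :=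
    Submodule.finrank_orthogonal_span_singleton he
  have : Nontrivial (ℂ ∙ e)ᗮ := Module.nontrivial_of_finrank_pos (R := ℂ) (by omega)
  have hlaw := hasLaw_norm_sq_starProjection_complexNormalVector (ℂ ∙ e)ᗮ hv
  rwa [hrank, Nat.cast_sub hι.le, Nat.cast_one] at hlaw

theorem hasLaw_complexNormalVector {Ω : Type*} [MeasurableSpace Ω] {μ : Measure Ω}
    {h : Ω → EuclideanSpace ℂ ι} (hm : Measurable h)
    (hlaw : μ.map (fun w i => h w i) = Measure.pi fun _ => complexNormal v) :
    HasLaw h (complexNormalVector v ι) μ := by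
  refine ⟨hm.aemeasurable, ?_⟩
  rw [complexNormalVector, ← hlaw, Measure.map_map (by fun_prop) (by fun_prop)]
  rfl

end ComplexGaussian

section Independence

variable {Ω α β γ : Type*} [MeasurableSpace Ω] [MeasurableSpace α] [MeasurableSpace β]
  [MeasurableSpace γ] {μ : Measure Ω}

theorem measure_prodMk_mem_of_indepFun [IsFiniteMeasure μ] {X : Ω → α} {Y : Ω → β}
    (hX : Measurable X) (hY : Measurable Y) (hXY : IndepFun X Y μ) {T : Set (α × β)}
    (hT : MeasurableSet T) :
    μ {w | (X w, Y w) ∈ T} = ∫⁻ x, μ {w | (x, Y w) ∈ T} ∂μ.map X := by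
  have hlaw := (indepFun_iff_map_prod_eq_prod_map_map hX.aemeasurable hY.aemeasurable).1 hXY
  calc μ {w | (X w, Y w) ∈ T}
      = μ.map (fun w => (X w, Y w)) T := (Measure.map_apply (hX.prodMk hY) hT).symm
    _ = ∫⁻ x, μ.map Y (Prod.mk x ⁻¹' T) ∂μ.map X := by rw [hlaw, Measure.prod_apply hT]
    _ = ∫⁻ x, μ {w | (x, Y w) ∈ T} ∂μ.map X :=
      lintegral_congr fun x => Measure.map_apply hY (measurable_prodMk_left hT)

theorem measure_prodMk_mem_le_setLIntegral_of_indepFun [IsFiniteMeasure μ] {X : Ω → α} {Y : Ω → β}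
    (hX : Measurable X) (hY : Measurable Y) (hXY : IndepFun X Y μ) {s : Set α}
    (hs : MeasurableSet s) {T : Set (α × β)} (hT : MeasurableSet T) {f : α → ENNReal}
    (hf : ∀ x ∈ s, μ {w | (x, Y w) ∈ T} ≤ f x) :
    μ {w | X w ∈ s ∧ (X w, Y w) ∈ T} ≤ ∫⁻ x in s, f x ∂μ.map X := by
  rw [← lintegral_indicator hs]
  refine (measure_prodMk_mem_of_indepFun hX hY hXY
    ((measurable_fst hs).inter hT)).trans_le (lintegral_mono fun x => ?_)
  by_cases hx : x ∈ s
  · simpa [hx] using hf x hx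
  · simp [hx]

theorem hasLaw_and_indepFun_of_ae_hasLaw [IsProbabilityMeasure μ] {X : Ω → α} {Y : Ω → β}
    (hX : Measurable X) (hY : Measurable Y) (hXY : IndepFun X Y μ) {g : α × β → γ}
    (hg : Measurable g) {ρ : Measure γ}
    (hρ : ∀ᵐ x ∂μ.map X, HasLaw (fun w => g (x, Y w)) ρ μ) :
    HasLaw (fun w => g (X w, Y w)) ρ μ ∧ IndepFun X (fun w => g (X w, Y w)) μ := by
  have hgm : Measurable fun w => g (X w, Y w) := hg.comp (hX.prodMk hY)
  have hinter {s : Set α} {t : Set γ} (hs : MeasurableSet s) (ht : MeasurableSet t) :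
      μ (X ⁻¹' s ∩ (fun w => g (X w, Y w)) ⁻¹' t) = μ (X ⁻¹' s) * ρ t := by
    rw [← Measure.map_apply hX hs, mul_comm, ← lintegral_indicator_const hs]
    refine (measure_prodMk_mem_of_indepFun hX hY hXY
      ((measurable_fst hs).inter (hg ht))).trans (lintegral_congr_ae ?_)
    filter_upwards [hρ] with x hx
    by_cases hxs : x ∈ s
    · simpa [hxs] using hx.measure_eq (p := (· ∈ t)) ht
    · simp [hxs]
  have hmap {t : Set γ} (ht : MeasurableSet t) : μ ((fun w => g (X w, Y w)) ⁻¹' t) = ρ t := by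
    simpa using hinter MeasurableSet.univ ht
  refine ⟨⟨hgm.aemeasurable, Measure.ext fun t ht => by rw [Measure.map_apply hgm ht, hmap ht]⟩,
    indepFun_iff_measure_inter_preimage_eq_mul.2 fun s t hs ht => ?_⟩
  rw [hinter hs ht, hmap ht]

theorem measure_mem_Icc_add_le_of_hasLaw_expMeasure [IsFiniteMeasure μ] {U V : Ω → ℝ} {r : ℝ}
    (hr : 0 < r) (a : ℝ) (hU : Measurable U) (hV : Measurable V)
    (hlaw : HasLaw U (expMeasure r) μ) (hUV : IndepFun U V μ) :
    μ {w | U w ∈ Set.Icc a (a + V w)} ≤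
      ENNReal.ofReal (r * Real.exp (-(r * a))) * ∫⁻ w, ENNReal.ofReal (V w) ∂μ := by
  have hT : MeasurableSet {q : ℝ × ℝ | q.2 ∈ Set.Icc a (a + q.1)} :=
    (measurableSet_le measurable_const measurable_snd).inter
      (measurableSet_le measurable_snd (by fun_prop))
  calc μ {w | U w ∈ Set.Icc a (a + V w)}
      = ∫⁻ x, μ {w | U w ∈ Set.Icc a (a + x)} ∂μ.map V :=
        measure_prodMk_mem_of_indepFun hV hU hUV.symm hT
    _ ≤ ∫⁻ x, ENNReal.ofReal (r * Real.exp (-(r * a))) * ENNReal.ofReal x ∂μ.map V :=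
        lintegral_mono fun x =>
          (hlaw.measure_eq measurableSet_Icc).trans_le (expMeasure_Icc_le hr a x)
    _ = ENNReal.ofReal (r * Real.exp (-(r * a))) * ∫⁻ w, ENNReal.ofReal (V w) ∂μ := by
        rw [lintegral_const_mul _ ENNReal.measurable_ofReal,
          lintegral_map ENNReal.measurable_ofReal hV]

theorem lintegral_ofReal_of_cdf_eq_pow [IsProbabilityMeasure μ] {E : Ω → ℝ} (hE : Measurable E)
    (hE0 : ∀ᵐ w ∂μ, 0 ≤ E w) {b : ℝ} (hb : 0 < b) {m : ℕ}
    (hcdf : ∀ τ, 0 ≤ τ → τ ≤ b → μ.real {w | E w ≤ τ} = (τ / b) ^ m) :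
    ∫⁻ w, ENNReal.ofReal (E w) ∂μ = ENNReal.ofReal (b * (m / (m + 1))) := by
  have htail (t : ℝ) : μ {w | t < E w} = ENNReal.ofReal (1 - μ.real {w | E w ≤ t}) := by
    rw [← probReal_compl_eq_one_sub (measurableSet_le hE measurable_const), ofReal_measureReal,
      Set.compl_ofPred]
    simp_rw [not_le]
  have htail_zero {t : ℝ} (ht : b < t) : μ {w | t < E w} = 0 := by
    rw [htail, ENNReal.ofReal_eq_zero, sub_nonpos]
    calc (1 : ℝ) = μ.real {w | E w ≤ b} := by rw [hcdf b hb.le le_rfl, div_self hb.ne', one_pow]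
      _ ≤ μ.real {w | E w ≤ t} := measureReal_mono fun w hw => le_trans hw ht.le
  have hint : ∫ t in 0..b, (1 - (t / b) ^ m) = b * (m / (m + 1)) := by
    rw [intervalIntegral.integral_sub (by simp) (Continuous.intervalIntegrable (by fun_prop) _ _),
      intervalIntegral.integral_comp_div (fun t => t ^ m) hb.ne', integral_pow,
      intervalIntegral.integral_const, div_self hb.ne', one_pow, zero_div,
      zero_pow m.succ_ne_zero, smul_eq_mul, smul_eq_mul]
    field_simp
    ring
  rw [lintegral_eq_lintegral_meas_lt μ hE0 hE.aemeasurable, ← Set.Ioc_union_Ioi_eq_Ioi hb.le,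
    lintegral_union measurableSet_Ioi (Set.Ioc_disjoint_Ioi le_rfl),
    setLIntegral_congr_fun measurableSet_Ioi fun t ht => htail_zero ht, lintegral_zero, add_zero,
    setLIntegral_congr_fun measurableSet_Ioc fun t ht => (htail t).trans
      (by rw [hcdf t ht.1.le ht.2]), ← hint, intervalIntegral.integral_of_le hb.le,
    ofReal_integral_eq_lintegral_ofReal (Continuous.integrableOn_Ioc (by fun_prop))]
  refine (ae_restrict_iff' measurableSet_Ioc).2 (ae_of_all _ fun t ht => ?_)
  exact sub_nonneg.2 (pow_le_one₀ (div_nonneg ht.1.le hb.le) ((div_le_one hb).2 ht.2))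

end Independence

section Beamforming

theorem norm_sq_starProjection_orthogonal_span_singleton {𝕜 E : Type*} [RCLike 𝕜]
    [NormedAddCommGroup E] [InnerProductSpace 𝕜 E] {e : E} (he : ‖e‖ = 1) (h : E) :
    ‖(𝕜 ∙ e)ᗮ.starProjection h‖ ^ 2 = ‖h‖ ^ 2 - ‖inner 𝕜 e h‖ ^ 2 := by
  rw [Submodule.norm_sq_eq_add_norm_sq_starProjection h (𝕜 ∙ e),
    Submodule.starProjection_unit_singleton 𝕜 he, norm_smul, he, mul_one, add_sub_cancel_left]

variable {L : ℕ}

theorem IsOCBBeamformer.mul_norm_sq_starProjection_le {e s f : EuclideanSpace ℂ (Fin L)} {P : ℝ}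
    (h : IsOCBBeamformer e s P f) :
    P * ‖(ℂ ∙ e)ᗮ.starProjection s‖ ^ 2 ≤ ‖inner ℂ f s‖ ^ 2 := by
  obtain ⟨⟨-, hfP⟩, hmax⟩ := h
  have hP : 0 ≤ P := (sq_nonneg _).trans hfP
  set v := (ℂ ∙ e)ᗮ.starProjection s with hv
  have hve : inner ℂ v e = 0 :=
    Submodule.mem_orthogonal_singleton_iff_inner_left.1 (Submodule.starProjection_apply_mem _ s)
  have hvs : inner ℂ v s = ((‖v‖ ^ 2 : ℝ) : ℂ) := by
    have hvv : (ℂ ∙ e)ᗮ.starProjection v = v :=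
      Submodule.starProjection_eq_self_iff.2 (Submodule.starProjection_apply_mem _ s)
    rw [← hvv, Submodule.inner_starProjection_left_eq_right, ← hv, hvv, inner_self_eq_norm_sq_to_K]
    push_cast
    rfl
  rcases eq_or_ne v 0 with hv0 | hv0
  · simp [hv0]
  have hr : 0 ≤ √P / ‖v‖ := by positivity
  have hv0' : ‖v‖ ≠ 0 := norm_ne_zero_iff.2 hv0
  calc P * ‖v‖ ^ 2 = ‖inner ℂ (((√P / ‖v‖ : ℝ) : ℂ) • v) s‖ ^ 2 := by
        rw [inner_smul_left, hvs, Complex.conj_ofReal, ← Complex.ofReal_mul, Complex.norm_real,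
          Real.norm_eq_abs, sq_abs, mul_pow, div_pow, Real.sq_sqrt hP]
        field_simp
    _ ≤ ‖inner ℂ f s‖ ^ 2 := by
        refine hmax _ (by rw [inner_smul_left, hve, mul_zero]) (le_of_eq ?_)
        rw [norm_smul, Complex.norm_real, Real.norm_of_nonneg hr, div_mul_cancel₀ _ hv0',
          Real.sq_sqrt hP]

@[fun_prop]
theorem measurable_channelShape :
    Measurable (channelShape : EuclideanSpace ℂ (Fin L) → EuclideanSpace ℂ (Fin L)) := by
  unfold channelShape
  exact Measurable.smul (f := fun h : EuclideanSpace ℂ (Fin L) => ((‖h‖⁻¹ : ℝ) : ℂ))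
    (by fun_prop) measurable_id

theorem norm_channelShape_le_one (h : EuclideanSpace ℂ (Fin L)) : ‖channelShape h‖ ≤ 1 := by
  rw [channelShape, norm_smul, Complex.norm_real, norm_inv, norm_norm]
  exact inv_mul_le_one

theorem norm_smul_channelShape (h : EuclideanSpace ℂ (Fin L)) :
    ((‖h‖ : ℝ) : ℂ) • channelShape h = h := by
  rcases eq_or_ne h 0 with rfl | h0
  · rw [norm_zero, Complex.ofReal_zero, zero_smul]
  · rw [channelShape, smul_smul, ← Complex.ofReal_mul, mul_inv_cancel₀ (norm_ne_zero_iff.2 h0),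
      Complex.ofReal_one, one_smul]

theorem norm_sq_mul_norm_sq_map_channelShape {E : Type*} [NormedAddCommGroup E] [NormedSpace ℂ E]
    (T : EuclideanSpace ℂ (Fin L) →ₗ[ℂ] E) (h : EuclideanSpace ℂ (Fin L)) :
    ‖h‖ ^ 2 * ‖T (channelShape h)‖ ^ 2 = ‖T h‖ ^ 2 := by
  rw [← mul_pow]
  congr 1
  conv_rhs => rw [← norm_smul_channelShape h, map_smul, norm_smul, Complex.norm_real, norm_norm]

end Beamforming

theorem le_codebookFloor {N : ℕ} {p : Fin N → ℝ} {i : Fin N} {x : ℝ} (h : p i ≤ x) :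
    p i ≤ codebookFloor p x :=
  le_csSup ⟨x, fun _ hq => hq.2⟩ ⟨⟨i, rfl⟩, h⟩

namespace SystemParams

variable (S : SystemParams)

theorem gammaP_pos : 0 < S.gammaP := div_pos S.Pp_pos S.noise_pos

theorem gammaMax_pos : 0 < S.gammaMax := div_pos S.Pmax_pos S.noise_pos

theorem thetaS_div_gammaMax_pos : 0 < S.thetaS / S.gammaMax := div_pos S.thetaS_pos S.gammaMax_pos

theorem thetaP_div_gammaP_pos : 0 < S.thetaP / S.gammaP := div_pos S.thetaP_pos S.gammaP_pos

theorem cast_L_sub_one_pos : (0 : ℝ) < (S.L : ℝ) - 1 :=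
  sub_pos.2 (Nat.one_lt_cast.2 S.two_le_L)

theorem phi_nonneg : 0 ≤ S.phi := by
  have hG := upperGamma_nonneg ((S.L : ℝ) - 2) S.thetaS_div_gammaMax_pos.le
  have hL := S.cast_L_sub_one_pos
  have hγ := S.gammaP_pos
  have hlam := S.lam_pos
  have hθp := S.thetaP_pos
  have hθs := S.thetaS_pos
  unfold phi
  positivity

theorem alpha_nonneg : 0 ≤ S.alpha :=
  mul_nonneg (Real.exp_pos _).le (div_nonneg (upperGamma_nonneg _ S.thetaS_div_gammaMax_pos.le)
    (Real.Gamma_pos_of_pos S.cast_L_sub_one_pos).le)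

end SystemParams

namespace ChannelModel

variable {S : SystemParams} {B : ℕ} {Ω : Type*} [MeasurableSpace Ω] {μ : Measure Ω}
  (X : ChannelModel S B μ)

/-- The gain of the secondary channel in the directions that the beamformer may use, i.e. of its
component orthogonal to the quantized shape of the cross channel. -/
noncomputable def orthGain (w : Ω) : ℝ := ‖(ℂ ∙ X.sHat w)ᗮ.starProjection (X.hs w)‖ ^ 2

theorem orthGain_nonneg (w : Ω) : 0 ≤ X.orthGain w := sq_nonneg _

theorem orthGain_eq (w : Ω) :
    X.orthGain w = ‖X.hs w‖ ^ 2 - ‖inner ℂ (X.sHat w) (X.hs w)‖ ^ 2 :=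
  norm_sq_starProjection_orthogonal_span_singleton (X.norm_sHat w) _

theorem measurable_hp_hx_sHat : Measurable fun w => (X.hp w, X.hx w, X.sHat w) :=
  X.measurable_hp.prodMk (X.measurable_hx.prodMk X.measurable_sHat)

theorem etaHat_mul_orthGain_le {N : ℕ} {p : Fin N → ℝ} {f : Ω → EuclideanSpace ℂ (Fin S.L)}
    {w : Ω} (hf : IsOCBBeamformer (X.sHat w) (channelShape (X.hs w)) (X.etaHat p w) (f w)) :
    X.etaHat p w * X.orthGain w ≤ S.noise * X.snrS f w := by
  have hT := norm_sq_mul_norm_sq_map_channelShape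
    ((ℂ ∙ X.sHat w)ᗮ.starProjection : _ →ₗ[ℂ] EuclideanSpace ℂ (Fin S.L)) (X.hs w)
  calc X.etaHat p w * X.orthGain w
      = X.gs w * (X.etaHat p w *
          ‖(ℂ ∙ X.sHat w)ᗮ.starProjection (channelShape (X.hs w))‖ ^ 2) := by
        rw [mul_left_comm, orthGain, gs]
        exact congrArg _ hT.symm
    _ ≤ X.gs w * ‖inner ℂ (f w) (channelShape (X.hs w))‖ ^ 2 :=
        mul_le_mul_of_nonneg_left hf.mul_norm_sq_starProjection_le (sq_nonneg _)
    _ = S.noise * X.snrS f w := by rw [snrS, ← mul_assoc, mul_div_cancel₀ _ S.noise_pos.ne']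

theorem hasLaw_orthGain_and_indepFun [IsProbabilityMeasure μ] :
    HasLaw X.orthGain (gammaMeasure ((S.L : ℝ) - 1) 1) μ ∧
      IndepFun (fun w => (X.hp w, X.hx w, X.sHat w)) X.orthGain μ := by
  have hnorm : ∀ᵐ q ∂μ.map fun w => (X.hp w, X.hx w, X.sHat w), ‖q.2.2‖ = 1 :=
    (ae_map_iff X.measurable_hp_hx_sHat.aemeasurable
      (measurableSet_eq_fun (by fun_prop) measurable_const)).2 (ae_of_all _ X.norm_sHat)
  have hproj (e : EuclideanSpace ℂ (Fin S.L)) (he : ‖e‖ = 1) :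
      HasLaw (fun w => ‖X.hs w‖ ^ 2 - ‖inner ℂ e (X.hs w)‖ ^ 2)
        (gammaMeasure ((S.L : ℝ) - 1) 1) μ := by
    have hlaw := (hasLaw_norm_sq_starProjection_orthogonal_complexNormalVector one_ne_zero
      (by rw [Fintype.card_fin]; exact S.two_le_L) (norm_ne_zero_iff.1 (he ▸ one_ne_zero))).comp
      (hasLaw_complexNormalVector X.measurable_hs X.law_hs)
    simp_rw [norm_sq_starProjection_orthogonal_span_singleton he] at hlaw
    simpa [Function.comp_def] using hlaw
  rw [funext X.orthGain_eq]
  exact hasLaw_and_indepFun_of_ae_hasLaw X.measurable_hp_hx_sHat X.measurable_hs X.indep_secondary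
    (g := fun q => ‖q.2‖ ^ 2 - ‖inner ℂ q.1.2.2 q.2‖ ^ 2) (by fun_prop)
    (hnorm.mono fun q hq => hproj q.2.2 hq)

@[fun_prop]
theorem measurable_orthGain : Measurable X.orthGain := by
  have hs := X.measurable_hs
  have hsHat := X.measurable_sHat
  rw [funext X.orthGain_eq]
  fun_prop

theorem measureReal_orthGain_le [IsProbabilityMeasure μ] {y : ℝ} (hy : 0 < y) :
    μ.real {w | X.orthGain w ≤ y} =
      1 - upperGamma ((S.L : ℝ) - 1) y / Real.Gamma ((S.L : ℝ) - 1) := by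
  have hcompl : {w | X.orthGain w ≤ y} = (X.orthGain ⁻¹' Set.Ioi y)ᶜ := by
    ext w
    simp
  have hGamma := Real.Gamma_pos_of_pos S.cast_L_sub_one_pos
  rw [hcompl, probReal_compl_eq_one_sub (X.measurable_orthGain measurableSet_Ioi), Measure.real,
    ← Measure.map_apply X.measurable_orthGain measurableSet_Ioi,
    X.hasLaw_orthGain_and_indepFun.1.map_eq, gammaMeasure_Ioi S.cast_L_sub_one_pos one_pos hy,
    one_mul, ENNReal.toReal_ofReal (div_nonneg (upperGamma_nonneg _ hy.le) hGamma.le)]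

@[fun_prop]
theorem measurable_gp : Measurable X.gp := X.measurable_hp.norm.pow_const 2

@[fun_prop]
theorem measurable_gx : Measurable X.gx := (X.measurable_hx.norm.pow_const 2).div_const _

@[fun_prop]
theorem measurable_eps : Measurable X.eps := by
  have hx := X.measurable_hx
  have hsHat := X.measurable_sHat
  unfold eps
  fun_prop

theorem gx_nonneg (w : Ω) : 0 ≤ X.gx w := div_nonneg (sq_nonneg _) S.lam_pos.le

theorem eps_nonneg (w : Ω) : 0 ≤ X.eps w := by
  have h := norm_inner_le_norm (𝕜 := ℂ) (X.sHat w) (channelShape (X.hx w))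
  rw [X.norm_sHat, one_mul] at h
  exact sub_nonneg.2 (pow_le_one₀ (norm_nonneg _) (h.trans (norm_channelShape_le_one _)))

theorem hasLaw_gp : HasLaw X.gp (expMeasure 1) μ := by
  have hlaw := (hasLaw_norm_sq_complexNormal one_ne_zero).comp
    ⟨X.measurable_hp.aemeasurable, X.law_hp⟩
  rwa [NNReal.coe_one, inv_one] at hlaw

theorem margin_nonneg_iff (w : Ω) : 0 ≤ X.margin w ↔ S.thetaP / S.gammaP ≤ X.gp w := by
  rw [margin, mul_nonneg_iff_of_pos_left S.noise_pos, sub_nonneg, one_le_div S.thetaP_pos,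
    div_le_iff₀' S.gammaP_pos]

theorem measure_margin_nonneg :
    μ {w | 0 ≤ X.margin w} = ENNReal.ofReal (Real.exp (-(S.thetaP / S.gammaP))) := by
  simp_rw [margin_nonneg_iff]
  rw [X.hasLaw_gp.measure_eq (p := (S.thetaP / S.gammaP ≤ ·)) measurableSet_Ici]
  exact (expMeasure_Ici one_pos S.thetaP_div_gammaP_pos.le).trans (by rw [one_mul])

theorem hasLaw_norm_sq_hx :
    HasLaw (fun w => ‖X.hx w‖ ^ 2) (gammaMeasure S.L S.lam⁻¹) μ := by
  have : Nonempty (Fin S.L) := ⟨⟨0, two_pos.trans_le S.two_le_L⟩⟩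
  simpa [Function.comp_def, S.lam_pos.le] using
    (hasLaw_norm_sq_complexNormalVector (by simpa using S.lam_pos)).comp
      (hasLaw_complexNormalVector X.measurable_hx X.law_hx)

theorem ae_gx_pos : ∀ᵐ w ∂μ, 0 < X.gx w := by
  have hpos : ∀ᵐ x ∂gammaMeasure S.L S.lam⁻¹, 0 < x := by
    simp_rw [ae_iff, not_lt]
    exact gammaMeasure_Iic_zero
  filter_upwards [(X.hasLaw_norm_sq_hx.ae_iff (p := (0 < ·)) (by fun_prop)).2 hpos] with w hw
  exact div_pos hw S.lam_pos

theorem ae_eps_pos [IsProbabilityMeasure μ] : ∀ᵐ w ∂μ, 0 < X.eps w := by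
  have hzero := X.cdf_le 0 le_rfl (by positivity)
  rw [zero_pow (Nat.sub_ne_zero_of_lt S.two_le_L), mul_zero, measureReal_eq_zero_iff] at hzero
  simpa [ae_iff, eps] using hzero

theorem lintegral_gx : ∫⁻ w, ENNReal.ofReal (X.gx w) ∂μ = ENNReal.ofReal S.L := by
  have hmean : ∫⁻ w, ENNReal.ofReal (‖X.hx w‖ ^ 2) ∂μ = ENNReal.ofReal (S.L * S.lam) := by
    rw [X.hasLaw_norm_sq_hx.lintegral_comp (f := ENNReal.ofReal) (by fun_prop),
      lintegral_ofReal_gammaMeasure (Nat.cast_pos.2 (two_pos.trans_le S.two_le_L))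
        (inv_pos.2 S.lam_pos), div_inv_eq_mul]
  simp_rw [gx, ENNReal.ofReal_div_of_pos S.lam_pos, div_eq_mul_inv]
  rw [lintegral_mul_const' _ _ (by simpa using S.lam_pos), hmean, ← div_eq_mul_inv,
    ← ENNReal.ofReal_div_of_pos S.lam_pos, mul_div_cancel_right₀ _ S.lam_pos.ne']

theorem lintegral_eps [IsProbabilityMeasure μ] :
    ∫⁻ w, ENNReal.ofReal (X.eps w) ∂μ =
      ENNReal.ofReal ((2 : ℝ) ^ (-(B : ℝ) / ((S.L : ℝ) - 1)) * (((S.L : ℝ) - 1) / S.L)) := by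
  have hcast : ((S.L - 1 : ℕ) : ℝ) = (S.L : ℝ) - 1 :=
    Nat.cast_pred (two_pos.trans_le S.two_le_L)
  set b : ℝ := (2 : ℝ) ^ (-(B : ℝ) / ((S.L : ℝ) - 1)) with hb
  have hbpow : b ^ (S.L - 1) = (2 ^ B)⁻¹ := by
    rw [hb, ← Real.rpow_mul_natCast two_pos.le, hcast, div_mul_cancel₀ _ S.cast_L_sub_one_pos.ne',
      Real.rpow_neg two_pos.le, Real.rpow_natCast]
  rw [lintegral_ofReal_of_cdf_eq_pow X.measurable_eps (ae_of_all _ X.eps_nonneg) (m := S.L - 1)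
    (b := b) (by positivity), hcast, sub_add_cancel]
  intro τ hτ hτb
  rw [div_pow, hbpow, div_inv_eq_mul, mul_comm]
  exact X.cdf_le τ hτ hτb

theorem indepFun_gx_eps : IndepFun X.gx X.eps μ :=
  X.indep_gain.comp (φ := fun r : ℝ => r ^ 2 / S.lam)
    (ψ := fun q : EuclideanSpace ℂ (Fin S.L) × EuclideanSpace ℂ (Fin S.L) =>
      1 - ‖inner ℂ q.2 q.1‖ ^ 2) (by fun_prop) (by fun_prop)

theorem lintegral_gx_mul_eps [IsProbabilityMeasure μ] :
    ∫⁻ w, ENNReal.ofReal (X.gx w * X.eps w) ∂μ =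
      ENNReal.ofReal (((S.L : ℝ) - 1) * (2 : ℝ) ^ (-(B : ℝ) / ((S.L : ℝ) - 1))) := by
  have hL : (0 : ℝ) < S.L := Nat.cast_pos.2 (two_pos.trans_le S.two_le_L)
  have hprod : ∫⁻ w, ENNReal.ofReal (X.gx w) * ENNReal.ofReal (X.eps w) ∂μ =
      (∫⁻ w, ENNReal.ofReal (X.gx w) ∂μ) * ∫⁻ w, ENNReal.ofReal (X.eps w) ∂μ :=
    lintegral_mul_eq_lintegral_mul_lintegral_of_indepFun (by fun_prop) (by fun_prop)
      (X.indepFun_gx_eps.comp ENNReal.measurable_ofReal ENNReal.measurable_ofReal)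
  simp_rw [ENNReal.ofReal_mul (X.gx_nonneg _)]
  rw [hprod, X.lintegral_gx, X.lintegral_eps, ← ENNReal.ofReal_mul hL.le]
  congr 1
  field_simp

@[fun_prop]
theorem measurable_margin : Measurable X.margin := by
  unfold margin
  fun_prop

open Classical in
@[fun_prop]
theorem measurable_eta : Measurable X.eta :=
  Measurable.ite (measurableSet_le measurable_const X.measurable_margin) (by fun_prop)
    measurable_const

theorem indepFun_orthGain_margin_eta [IsProbabilityMeasure μ] :
    IndepFun X.orthGain (fun w => (X.margin w, X.eta w)) μ := by
  classical
  let m (q : ℂ × EuclideanSpace ℂ (Fin S.L) × EuclideanSpace ℂ (Fin S.L)) : ℝ :=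
    S.noise * (S.gammaP * ‖q.1‖ ^ 2 / S.thetaP - 1)
  let e (q : ℂ × EuclideanSpace ℂ (Fin S.L) × EuclideanSpace ℂ (Fin S.L)) : ℝ :=
    if 0 ≤ m q then
      m q / (S.lam * (‖q.2.1‖ ^ 2 / S.lam) * (1 - ‖inner ℂ q.2.2 (channelShape q.2.1)‖ ^ 2))
    else S.Pmax
  have hm : Measurable m := by fun_prop
  have he : Measurable e :=
    Measurable.ite (measurableSet_le measurable_const hm) (by fun_prop) measurable_const
  exact (X.hasLaw_orthGain_and_indepFun.2.comp (hm.prodMk he) measurable_id).symm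

theorem gp_le_of_eta_mul_le {w : Ω} {y c : ℝ} (hmargin : 0 ≤ X.margin w) (hgx : 0 < X.gx w)
    (heps : 0 < X.eps w) (hy : 0 < y) (h : X.eta w * y ≤ c) :
    X.gp w ≤ S.thetaP / S.gammaP +
      S.thetaP / S.gammaP * (S.lam * c / (S.noise * y)) * (X.gx w * X.eps w) := by
  have hlam := S.lam_pos
  have hnoise := S.noise_pos
  have hth := S.thetaP_pos
  have hγ := S.gammaP_pos
  have hden : 0 < S.lam * X.gx w * X.eps w := by positivity
  rw [eta, if_pos hmargin, ← le_div_iff₀ hy, div_le_iff₀ hden, margin, ← le_div_iff₀' hnoise,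
    sub_le_iff_le_add', div_le_iff₀ hth, ← le_div_iff₀' hγ] at h
  refine h.trans_eq ?_
  field_simp

theorem measure_margin_nonneg_and_eta_mul_le [IsProbabilityMeasure μ] {y c : ℝ} (hy : 0 < y)
    (hc : 0 ≤ c) :
    μ {w | 0 ≤ X.margin w ∧ X.eta w * y ≤ c} ≤
      ENNReal.ofReal (Real.exp (-(S.thetaP / S.gammaP)) *
        (S.thetaP / S.gammaP * (S.lam * c / (S.noise * y)) *
          (((S.L : ℝ) - 1) * (2 : ℝ) ^ (-(B : ℝ) / ((S.L : ℝ) - 1))))) := by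
  have ha := S.thetaP_div_gammaP_pos
  have hlam := S.lam_pos
  have hnoise := S.noise_pos
  set a := S.thetaP / S.gammaP
  set k := a * (S.lam * c / (S.noise * y))
  have hk : 0 ≤ k := by positivity
  have hindep : IndepFun X.gp (fun w => k * (X.gx w * X.eps w)) μ :=
    X.indep_primary.comp (φ := fun z : ℂ => ‖z‖ ^ 2)
      (ψ := fun q : EuclideanSpace ℂ (Fin S.L) × EuclideanSpace ℂ (Fin S.L) =>
        k * (‖q.1‖ ^ 2 / S.lam * (1 - ‖inner ℂ q.2 (channelShape q.1)‖ ^ 2)))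
      (by fun_prop) (by fun_prop)
  calc μ {w | 0 ≤ X.margin w ∧ X.eta w * y ≤ c}
      ≤ μ {w | X.gp w ∈ Set.Icc a (a + k * (X.gx w * X.eps w))} := by
        refine measure_mono_ae ?_
        filter_upwards [X.ae_gx_pos, X.ae_eps_pos] with w hgx heps
        rintro ⟨hmargin, heta⟩
        exact ⟨(X.margin_nonneg_iff w).1 hmargin, X.gp_le_of_eta_mul_le hmargin hgx heps hy heta⟩
    _ ≤ ENNReal.ofReal (1 * Real.exp (-(1 * a))) *
          ∫⁻ w, ENNReal.ofReal (k * (X.gx w * X.eps w)) ∂μ :=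
        measure_mem_Icc_add_le_of_hasLaw_expMeasure one_pos a X.measurable_gp (by fun_prop)
          X.hasLaw_gp hindep
    _ = _ := by
        simp_rw [ENNReal.ofReal_mul hk]
        rw [lintegral_const_mul' _ _ ENNReal.ofReal_ne_top, X.lintegral_gx_mul_eps, one_mul,
          one_mul, ENNReal.ofReal_mul (Real.exp_pos _).le]
        congr 1
        rw [ENNReal.ofReal_mul hk]

theorem measure_eta_mul_orthGain_le [IsProbabilityMeasure μ] :
    μ {w | S.thetaS / S.gammaMax < X.orthGain w ∧ 0 ≤ X.margin w ∧
        X.eta w * X.orthGain w ≤ S.noise * S.thetaS} ≤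
      ENNReal.ofReal (S.phi * (2 : ℝ) ^ (-(B : ℝ) / ((S.L : ℝ) - 1))) := by
  set y := S.thetaS / S.gammaMax with hy_def
  set b := (2 : ℝ) ^ (-(B : ℝ) / ((S.L : ℝ) - 1)) with hb_def
  set K := Real.exp (-(S.thetaP / S.gammaP)) *
    (S.thetaP / S.gammaP * (S.lam * S.thetaS) * (((S.L : ℝ) - 1) * b)) with hK_def
  have hy : 0 < y := S.thetaS_div_gammaMax_pos
  have hL := S.cast_L_sub_one_pos
  have hlam := S.lam_pos
  have hnoise := S.noise_pos
  have hth := S.thetaS_pos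
  have ha := S.thetaP_div_gammaP_pos
  have hK : 0 ≤ K := by positivity
  have hT : MeasurableSet {q : ℝ × ℝ × ℝ | 0 ≤ q.2.1 ∧ q.2.2 * q.1 ≤ S.noise * S.thetaS} := by
    measurability
  have hfreeze : ∀ t ∈ Set.Ioi y, μ {w | 0 ≤ X.margin w ∧ X.eta w * t ≤ S.noise * S.thetaS} ≤
      ENNReal.ofReal (K * t ^ (-1 : ℝ)) := fun t ht => by
    have ht0 : 0 < t := hy.trans ht
    refine (X.measure_margin_nonneg_and_eta_mul_le ht0 (by positivity)).trans_eq ?_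
    congr 1
    rw [← hb_def, Real.rpow_neg_one, hK_def]
    field_simp
  calc _ ≤ ∫⁻ t in Set.Ioi y, ENNReal.ofReal (K * t ^ (-1 : ℝ)) ∂μ.map X.orthGain :=
        measure_prodMk_mem_le_setLIntegral_of_indepFun X.measurable_orthGain (by fun_prop)
          X.indepFun_orthGain_margin_eta measurableSet_Ioi
          hT hfreeze
    _ = ENNReal.ofReal (K * (upperGamma ((S.L : ℝ) - 2) y / Real.Gamma ((S.L : ℝ) - 1))) := by
        have hexp : (S.L : ℝ) - 1 + -1 = S.L - 2 := by ring
        simp_rw [ENNReal.ofReal_mul hK]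
        rw [X.hasLaw_orthGain_and_indepFun.1.map_eq,
          lintegral_const_mul' _ _ ENNReal.ofReal_ne_top,
          setLIntegral_Ioi_rpow_gammaMeasure hL one_pos _ hy, hexp, Real.one_rpow, one_mul, one_mul]
    _ = ENNReal.ofReal (S.phi * b) := by
        have hγ := S.gammaP_pos.ne'
        have hΓ := (Real.Gamma_pos_of_pos hL).ne'
        congr 1
        rw [hK_def, SystemParams.phi, ← hy_def]
        field_simp

theorem measure_margin_nonneg_inter [IsFiniteMeasure μ] (s : Set Ω) :
    μ ({w | 0 ≤ X.margin w} ∩ s) =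
      ENNReal.ofReal (Real.exp (-(S.thetaP / S.gammaP)) *
        (μ[|{w | S.thetaP ≤ S.gammaP * X.gp w}]).real s) := by
  have hG : {w | S.thetaP ≤ S.gammaP * X.gp w} = {w | 0 ≤ X.margin w} := by
    simp_rw [margin_nonneg_iff, div_le_iff₀' S.gammaP_pos]
  rw [hG, ← cond_mul_eq_inter (measurableSet_le measurable_const X.measurable_margin),
    X.measure_margin_nonneg, ENNReal.ofReal_mul (Real.exp_pos _).le, ofReal_measureReal, mul_comm]

namespace IsIPCCodebook

variable {X} {A : ℕ} {p : Fin (2 ^ A) → ℝ}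

theorem measure_gap_le [IsFiniteMeasure μ] (hp : X.IsIPCCodebook p) {x : ℝ} (hx : 0 ≤ x) :
    μ {w | 0 ≤ X.margin w ∧ x < X.eta w ∧ ∀ i, p i ≤ X.eta w → p i ≤ x} ≤
      ENNReal.ofReal (Real.exp (-(S.thetaP / S.gammaP)) * (1 / 2 ^ A)) := by
  obtain ⟨n, -, hn⟩ := Finite.exists_le_maximal (p := (p · ≤ x)) (hp.zero.trans_le hx)
  by_cases h : (n : ℕ) + 1 < 2 ^ A
  · rw [← hp.step n h, ← X.measure_margin_nonneg_inter]
    refine measure_mono fun w ⟨hmargin, hxeta, hgap⟩ => ⟨hmargin, hn.1.trans_lt hxeta, ?_⟩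
    by_contra! hlt
    exact hn.not_prop_of_gt (Fin.lt_def.2 (Nat.lt_succ_self n)) (hgap _ hlt.le)
  · have hlast : n = ⟨2 ^ A - 1, Nat.sub_one_lt_of_lt (Nat.two_pow_pos A)⟩ :=
      Fin.ext (by have := n.2; lia)
    rw [← hp.last, ← hlast, ← X.measure_margin_nonneg_inter]
    exact measure_mono fun w ⟨hmargin, hxeta, _⟩ => ⟨hmargin, hn.1.trans_lt hxeta⟩

theorem measure_gap_orthGain_le [IsProbabilityMeasure μ] (hp : X.IsIPCCodebook p) {c : ℝ}
    (hc : 0 ≤ c) :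
    μ {w | S.thetaS / S.gammaMax < X.orthGain w ∧ 0 ≤ X.margin w ∧
        c < X.eta w * X.orthGain w ∧ ∀ i, p i ≤ X.eta w → p i * X.orthGain w ≤ c} ≤
      ENNReal.ofReal (S.alpha * (2 : ℝ) ^ (-(A : ℝ))) := by
  have hy := S.thetaS_div_gammaMax_pos
  have hT : MeasurableSet {q : ℝ × ℝ × ℝ | 0 ≤ q.2.1 ∧ c < q.2.2 * q.1 ∧
      ∀ i, p i ≤ q.2.2 → p i * q.1 ≤ c} := by
    measurability
  have hfreeze : ∀ t ∈ Set.Ioi (S.thetaS / S.gammaMax),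
      μ {w | 0 ≤ X.margin w ∧ c < X.eta w * t ∧ ∀ i, p i ≤ X.eta w → p i * t ≤ c} ≤
        ENNReal.ofReal (Real.exp (-(S.thetaP / S.gammaP)) * (1 / 2 ^ A)) := fun t ht => by
    have ht0 : 0 < t := hy.trans ht
    simp_rw [← div_lt_iff₀ ht0, ← le_div_iff₀ ht0]
    exact hp.measure_gap_le (div_nonneg hc ht0.le)
  calc _ ≤ ∫⁻ _ in Set.Ioi (S.thetaS / S.gammaMax),
          ENNReal.ofReal (Real.exp (-(S.thetaP / S.gammaP)) * (1 / 2 ^ A)) ∂μ.map X.orthGain :=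
        measure_prodMk_mem_le_setLIntegral_of_indepFun X.measurable_orthGain (by fun_prop)
          X.indepFun_orthGain_margin_eta measurableSet_Ioi hT hfreeze
    _ = ENNReal.ofReal (S.alpha * (2 : ℝ) ^ (-(A : ℝ))) := by
        rw [setLIntegral_const, X.hasLaw_orthGain_and_indepFun.1.map_eq,
          gammaMeasure_Ioi S.cast_L_sub_one_pos one_pos hy, one_mul,
          ← ENNReal.ofReal_mul (by positivity), mul_right_comm,
          SystemParams.alpha, one_div, Real.rpow_neg two_pos.le, Real.rpow_natCast]

end IsIPCCodebook

theorem outage_subset {N : ℕ} {p : Fin N → ℝ} {f : Ω → EuclideanSpace ℂ (Fin S.L)}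
    (hf : ∀ w, IsOCBBeamformer (X.sHat w) (channelShape (X.hs w)) (X.etaHat p w) (f w)) :
    {w | X.snrS f w ≤ S.thetaS} ⊆
      {w | X.orthGain w ≤ S.thetaS / S.gammaMax} ∪
        ({w | S.thetaS / S.gammaMax < X.orthGain w ∧ 0 ≤ X.margin w ∧
          X.eta w * X.orthGain w ≤ S.noise * S.thetaS} ∪
        {w | S.thetaS / S.gammaMax < X.orthGain w ∧ 0 ≤ X.margin w ∧
          S.noise * S.thetaS < X.eta w * X.orthGain w ∧
          ∀ i, p i ≤ X.eta w → p i * X.orthGain w ≤ S.noise * S.thetaS}) := by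
  intro w hw
  have hpower : X.etaHat p w * X.orthGain w ≤ S.noise * S.thetaS :=
    (X.etaHat_mul_orthGain_le (hf w)).trans (mul_le_mul_of_nonneg_left hw S.noise_pos.le)
  rcases le_or_gt (X.orthGain w) (S.thetaS / S.gammaMax) with hfull | hfull
  · exact Or.inl hfull
  have hPmax : S.noise * S.thetaS < S.Pmax * X.orthGain w := by
    rwa [SystemParams.gammaMax, div_div_eq_mul_div, div_lt_iff₀ S.Pmax_pos, mul_comm S.thetaS,
      mul_comm (X.orthGain w)] at hfull
  have hactive : 0 ≤ X.margin w ∧ X.eta w < S.Pmax := by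
    by_contra hinactive
    rw [etaHat, if_neg hinactive] at hpower
    exact hPmax.not_ge hpower
  rw [etaHat, if_pos hactive] at hpower
  rcases le_or_gt (X.eta w * X.orthGain w) (S.noise * S.thetaS) with heta | heta
  · exact Or.inr (Or.inl ⟨hfull, hactive.1, heta⟩)
  · exact Or.inr (Or.inr ⟨hfull, hactive.1, heta, fun i hi =>
      (mul_le_mul_of_nonneg_right (le_codebookFloor hi) (X.orthGain_nonneg w)).trans hpower⟩)

end ChannelModel

theorem mainTheorem4_general {S : SystemParams} {A B : ℕ} {Ω : Type*} [MeasurableSpace Ω]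
    {μ : Measure Ω} [IsProbabilityMeasure μ] {X : ChannelModel S B μ} {p : Fin (2 ^ A) → ℝ}
    {f : Ω → EuclideanSpace ℂ (Fin S.L)} (hp : X.IsIPCCodebook p)
    (hf : ∀ w, IsOCBBeamformer (X.sHat w) (channelShape (X.hs w)) (X.etaHat p w) (f w)) :
    X.outage f ≤
      1 - upperGamma ((S.L : ℝ) - 1) (S.thetaS / S.gammaMax) / Real.Gamma ((S.L : ℝ) - 1)
        + S.phi * (2 : ℝ) ^ (-(B : ℝ) / ((S.L : ℝ) - 1))
        + S.alpha * (2 : ℝ) ^ (-(A : ℝ)) := by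
  have hinterference := ENNReal.toReal_le_of_le_ofReal
    (mul_nonneg S.phi_nonneg (by positivity)) X.measure_eta_mul_orthGain_le
  have hquantization := ENNReal.toReal_le_of_le_ofReal
    (mul_nonneg S.alpha_nonneg (by positivity))
    (hp.measure_gap_orthGain_le (mul_pos S.noise_pos S.thetaS_pos).le)
  refine (measureReal_mono (X.outage_subset hf)).trans ((measureReal_union_le _ _).trans ?_)
  rw [X.measureReal_orthGain_le S.thetaS_div_gammaMax_pos, add_assoc]
  exact add_le_add_right
    ((measureReal_union_le _ _).trans (add_le_add hinterference hquantization)) _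

/-- The constant `C` of the error term depends on the system parameters only: not on the numbers of
bits `A` and `B`, nor on the realization of the random model. -/
theorem mainTheorem4 (S : SystemParams) :
    ∃ C : ℝ, ∀ (A B : ℕ) (Ω : Type u) [MeasurableSpace Ω] (μ : Measure Ω) [IsProbabilityMeasure μ]
      (X : ChannelModel S B μ) (p : Fin (2 ^ A) → ℝ) (f : Ω → EuclideanSpace ℂ (Fin S.L)),
      X.IsIPCCodebook p →
      (∀ w, IsOCBBeamformer (X.sHat w) (channelShape (X.hs w)) (X.etaHat p w) (f w)) →
      X.outage f ≤
        1 - upperGamma ((S.L : ℝ) - 1) (S.thetaS / S.gammaMax) / Real.Gamma ((S.L : ℝ) - 1)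
          + S.phi * (2 : ℝ) ^ (-(B : ℝ) / ((S.L : ℝ) - 1))
          + S.alpha * (2 : ℝ) ^ (-(A : ℝ))
          + C * (2 : ℝ) ^ (-(2 * (B : ℝ)) / ((S.L : ℝ) - 1)) := by
  refine ⟨0, fun A B Ω _ μ _ X p f hp hf => ?_⟩
  simpa only [zero_mul, add_zero] using mainTheorem4_general hp hf
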